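/- Let $K$ be a field of characteristic zero and let $A$ be a cofree coalgebra over $K$, i.e. a coalgebra isomorphic to the tensor space $T(V)=\bigoplus_{n\ge 0}V^{\otimes n}$ of some $K$-vector space $V$ with the deconcatenation coproduct $\Delta(v_1\cdots v_n)=\sum_{i=0}^n v_1\cdots v_i\otimes v_{i+1}\cdots v_n$ and the counit that vanishes on words of positive length and sends the empty word to $1$. Let $1$ denote the unique group-like element of $A$ (it is the unit of every Hopf algebra $(A,*,\Delta)$), let $A_+=\ker\varepsilon$ be the kernel of the counit, $\mathrm{Prim}(A)=\{x\in A: \Delta(x)=x\otimes 1+1\otimes x\}$, and for $a\in A_+$ write $\tilde\Delta(a)=\Delta(a)-a\otimes 1-1\otimes a=a'\otimes a''\in A_+\otimes A_+$. A pair $(\prec,\succ)$ of bilinear products $A_+\times A_+\to A_+$ makes $(A,\prec,\succ,\Delta)$ a dendriform Hopf algebra if, with $*=\prec+\succ$ on $A_+$, extended to $A$ with $1$ as a unit, $(A,*,\Delta)$ is a Hopf algebra; for all $x,y,z\in A_+$, $$(x\prec y)\prec z=x\prec(y*z),\qquad (x\succ y)\prec z=x\succ(y\prec z),\qquad (x*y)\succ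 z=x\succ(y\succ z);$$ and for all $a,b\in A_+$, $$\tilde\Delta(a\prec b)=a'*b'\otimes a''\prec b''+a'*b\otimes a''+b'\otimes a\prec b''+a'\otimes a''\prec b+b\otimes a,$$ $$\tilde\Delta(a\succ b)=a'*b'\otimes a''\succ b''+a*b'\otimes b''+b'\otimes a\succ b''+a'\otimes a''\succ b+a\otimes b.$$ Let $\mathcal{DD}(A)$ be the set of pairs $(\prec,\succ)$ such that $(A,\prec,\succ,\Delta)$ is a dendriform Hopf algebra, and let $\mathcal{LI}(A)$ be the set of pairs $(*,I)$ such that $(A,*,\Delta)$ is a Hopf algebra and $I$ is a left ideal of $(A,*)$ with $A_+=\mathrm{Prim}(A)\oplus I$. Then the map $$\Phi_A:\mathcal{DD}(A)\longrightarrow\mathcal{LI}(A),\qquad (\prec,\succ)\longmapsto(\prec+\succ,\;A_+\prec A_+)$$ is well defined and is a bijection. Here $\prec+\succ$ stands for its extension to $A$ with unit $1$, and $A_+\prec A_+$ is the linear span of all $a\prec b$ with $a,b\in A_+$. -/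

import Mathlib

open scoped TensorProduct

noncomputable section

universe v

namespace CofreeDendriform

open Coalgebra

variable (K : Type*) [Field K]

/-- The word `v₁ v₂ ⋯ vₙ` in the tensor algebra `T(V)`, for a list `[v₁, …, vₙ]` of vectors. -/
def word {V : Type*} [AddCommGroup V] [Module K V] (l : List V) : TensorAlgebra K V :=
  (l.map (TensorAlgebra.ι K)).prod

/-- A coalgebra `A` is cofree if it is isomorphic, as a coalgebra, to `T(V)` with the
deconcatenation coproduct `Δ(v₁ ⋯ vₙ) = ∑ᵢ v₁ ⋯ vᵢ ⊗ vᵢ₊₁ ⋯ vₙ`, for some vector space `V`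
(the counit of `T(V)` is the projection on words of length zero).
As the words span `T(V)`, it is enough to describe the coproduct and counit on them. -/
def IsCofree (A : Type v) [AddCommGroup A] [Module K A] [Coalgebra K A] : Prop :=
  ∃ (V : Type v) (_ : AddCommGroup V) (_ : Module K V) (φ : TensorAlgebra K V ≃ₗ[K] A),
    (∀ l : List V, (comul (φ (word K l)) : A ⊗[K] A) =
      ∑ i ∈ Finset.range (l.length + 1), φ (word K (l.take i)) ⊗ₜ[K] φ (word K (l.drop i))) ∧
    (∀ v : V, ∀ l : List V, counit (R := K) (φ (word K (v :: l))) = 0) ∧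
    counit (R := K) (φ (word K [])) = 1

variable {A : Type*} [AddCommGroup A] [Module K A] [Coalgebra K A]

variable (A) in
/-- `A₊`, the kernel of the counit. -/
abbrev augKer : Submodule K A := LinearMap.ker (counit : A →ₗ[K] K)

/-- The space of elements `x` that are primitive with respect to `u`,
i.e. `Δ(x) = x ⊗ u + u ⊗ x`. -/
def primitives (u : A) : Submodule K A where
  carrier := {x | comul x = x ⊗ₜ[K] u + u ⊗ₜ[K] x}
  add_mem' {x y} hx hy := by
    simp only [Set.mem_ofPred_eq] at *
    rw [map_add, hx, hy, TensorProduct.add_tmul, TensorProduct.tmul_add]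
    abel
  zero_mem' := by simp
  smul_mem' c x hx := by
    simp only [Set.mem_ofPred_eq] at *
    rw [map_smul, hx, smul_add, TensorProduct.smul_tmul', TensorProduct.tmul_smul]

/-- `(A, m, Δ)` is a Hopf algebra with unit `u`: here `A` is a given coalgebra and `m` is a
bilinear product on it. -/
structure IsHopf (m : A →ₗ[K] A →ₗ[K] A) (u : A) : Prop where
  mul_assoc : ∀ a b c, m (m a b) c = m a (m b c)
  one_mul : ∀ a, m u a = a
  mul_one : ∀ a, m a u = a
  comul_one : comul u = u ⊗ₜ[K] u
  comul_mul : ∀ a b, comul (m a b) = TensorProduct.map₂ m m (comul a) (comul b)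
  counit_one : counit (R := K) u = 1
  counit_mul : ∀ a b, counit (R := K) (m a b) = counit (R := K) a * counit (R := K) b
  exists_antipode : ∃ S : A →ₗ[K] A,
    (∀ a, TensorProduct.lift m (S.rTensor A (comul a)) = counit (R := K) a • u) ∧
    (∀ a, TensorProduct.lift m (S.lTensor A (comul a)) = counit (R := K) a • u)

variable {K}

/-- The projection `a ↦ a - ε(a) e` of `A` on `A₊`, where `e` is a group-like element, playing
the role of the unit `1` of `A`. -/
def augProj {e : A} (he : IsGroupLikeElem K e) : A →ₗ[K] augKer K A :=
  LinearMap.codRestrict (augKer K A) (LinearMap.id - (counit : A →ₗ[K] K).smulRight e)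
    (fun a => by simp [he.counit_eq_one])

/-- The reduced coproduct `A₊ → A₊ ⊗ A₊`, `a ↦ Δ(a) - a ⊗ e - e ⊗ a`
(see `map_subtype_redComul` for this formula). -/
def redComul {e : A} (he : IsGroupLikeElem K e) : augKer K A →ₗ[K] augKer K A ⊗[K] augKer K A :=
  TensorProduct.map (augProj he) (augProj he) ∘ₗ comul ∘ₗ (augKer K A).subtype

theorem map_subtype_redComul {e : A} (he : IsGroupLikeElem K e) (a : augKer K A) :
    TensorProduct.map (augKer K A).subtype (augKer K A).subtype (redComul he a) =
      comul (a : A) - (a : A) ⊗ₜ[K] e - e ⊗ₜ[K] (a : A) := by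
  have h : (augKer K A).subtype ∘ₗ augProj he =
      LinearMap.id - (counit : A →ₗ[K] K).smulRight e := rfl
  have hs : (counit : A →ₗ[K] K).smulRight e = LinearMap.toSpanSingleton K A e ∘ₗ counit := by
    ext; simp
  have ha : counit (R := K) (a : A) = 0 := a.2
  have h1 : TensorProduct.map LinearMap.id ((counit : A →ₗ[K] K).smulRight e) (comul (a : A)) =
      (a : A) ⊗ₜ[K] e := by
    have := congrArg (LinearMap.lTensor A (LinearMap.toSpanSingleton K A e))
      (lTensor_counit_comul (R := K) (a : A))
    rw [← LinearMap.comp_apply, ← LinearMap.lTensor_comp, ← hs] at this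
    simpa [LinearMap.lTensor] using this
  have h2 : TensorProduct.map ((counit : A →ₗ[K] K).smulRight e) LinearMap.id (comul (a : A)) =
      e ⊗ₜ[K] (a : A) := by
    have := congrArg (LinearMap.rTensor A (LinearMap.toSpanSingleton K A e))
      (rTensor_counit_comul (R := K) (a : A))
    rw [← LinearMap.comp_apply, ← LinearMap.rTensor_comp, ← hs] at this
    simpa [LinearMap.rTensor] using this
  have h3 : TensorProduct.map ((counit : A →ₗ[K] K).smulRight e)
      ((counit : A →ₗ[K] K).smulRight e) (comul (a : A)) = 0 := by
    have h4 := congrArg (TensorProduct.map LinearMap.id ((counit : A →ₗ[K] K).smulRight e)) h2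
    rw [← LinearMap.comp_apply, ← TensorProduct.map_comp] at h4
    simpa [ha] using h4
  have h5 (f : A →ₗ[K] A) : TensorProduct.map (LinearMap.id - f) (LinearMap.id - f) =
      LinearMap.id - TensorProduct.map LinearMap.id f - TensorProduct.map f LinearMap.id
        + TensorProduct.map f f := by
    ext x y
    simp only [TensorProduct.AlgebraTensorModule.curry_apply, TensorProduct.curry_apply,
      LinearMap.restrictScalars_self, TensorProduct.map_tmul, LinearMap.sub_apply,
      LinearMap.add_apply, LinearMap.id_apply, TensorProduct.sub_tmul, TensorProduct.tmul_sub]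
    abel
  rw [redComul, LinearMap.comp_apply, LinearMap.comp_apply, ← LinearMap.comp_apply,
    ← TensorProduct.map_comp, h, h5]
  simp [h1, h2, h3]

/-- The product on `A` with unit `e` which extends a product `m` given on `A₊`:
`(s e + x) * (t e + y) = s t e + s y + t x + m x y` for scalars `s, t` and `x, y ∈ A₊`. -/
def unitalExt {e : A} (he : IsGroupLikeElem K e)
    (m : augKer K A →ₗ[K] augKer K A →ₗ[K] augKer K A) : A →ₗ[K] A →ₗ[K] A :=
  LinearMap.mk₂ K
    (fun a b => (counit (R := K) a * counit (R := K) b) • e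
      + counit (R := K) a • (augProj he b : A) + counit (R := K) b • (augProj he a : A)
      + (m (augProj he a) (augProj he b) : A))
    (fun a a' b => by
      simp only [map_add, LinearMap.add_apply, Submodule.coe_add]; module)
    (fun c a b => by
      simp only [map_smul, LinearMap.smul_apply, Submodule.coe_smul, smul_eq_mul]; module)
    (fun a b b' => by
      simp only [map_add, Submodule.coe_add]; module)
    (fun c a b => by
      simp only [map_smul, Submodule.coe_smul, smul_eq_mul]; module)

/-- `(A, ≺, ≻, Δ)` is a dendriform Hopf algebra: `A` is a Hopf algebra (with unit `e`) whose
product `*` splits on `A₊` as `≺ + ≻`, with the three dendriform axioms and the two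
compatibilities with the reduced coproduct `a ↦ a' ⊗ a''`. Here `p` is `≺` and `s` is `≻`. -/
structure IsDendriformHopf {e : A} (he : IsGroupLikeElem K e)
    (p s : augKer K A →ₗ[K] augKer K A →ₗ[K] augKer K A) : Prop where
  isHopf : IsHopf K (unitalExt he (p + s)) e
  /-- `(x ≺ y) ≺ z = x ≺ (y * z)` -/
  left_left : ∀ x y z, p (p x y) z = p x ((p + s) y z)
  /-- `(x ≻ y) ≺ z = x ≻ (y ≺ z)` -/
  right_left : ∀ x y z, p (s x y) z = s x (p y z)
  /-- `(x * y) ≻ z = x ≻ (y ≻ z)` -/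
  right_right : ∀ x y z, s ((p + s) x y) z = s x (s y z)
  /-- `Δ̃(a ≺ b) = a' * b' ⊗ a'' ≺ b'' + a' * b ⊗ a'' + b' ⊗ a ≺ b'' + a' ⊗ a'' ≺ b + b ⊗ a` -/
  redComul_left : ∀ a b, redComul he (p a b) =
    TensorProduct.map₂ (p + s) p (redComul he a) (redComul he b)
      + ((p + s).flip b).rTensor (augKer K A) (redComul he a)
      + (p a).lTensor (augKer K A) (redComul he b)
      + (p.flip b).lTensor (augKer K A) (redComul he a)
      + b ⊗ₜ[K] a
  /-- `Δ̃(a ≻ b) = a' * b' ⊗ a'' ≻ b'' + a * b' ⊗ b'' + b' ⊗ a ≻ b'' + a' ⊗ a'' ≻ b + a ⊗ b` -/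
  redComul_right : ∀ a b, redComul he (s a b) =
    TensorProduct.map₂ (p + s) s (redComul he a) (redComul he b)
      + ((p + s) a).rTensor (augKer K A) (redComul he b)
      + (s a).lTensor (augKer K A) (redComul he b)
      + (s.flip b).lTensor (augKer K A) (redComul he a)
      + a ⊗ₜ[K] b

/-- The set of pairs `(≺, ≻)` such that `(A, ≺, ≻, Δ)` is a dendriform Hopf algebra. -/
def DD {e : A} (he : IsGroupLikeElem K e) :
    Set ((augKer K A →ₗ[K] augKer K A →ₗ[K] augKer K A) ×
      (augKer K A →ₗ[K] augKer K A →ₗ[K] augKer K A)) :=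
  {d | IsDendriformHopf he d.1 d.2}

variable (K A) in
/-- The set of pairs `(*, I)` such that `(A, *, Δ)` is a Hopf algebra (with some unit `u`) and `I`
is a left ideal of it with `A₊ = Prim(A) ⊕ I`. -/
def LI : Set ((A →ₗ[K] A →ₗ[K] A) × Submodule K A) :=
  {q | ∃ u : A, IsHopf K q.1 u ∧ (∀ a : A, ∀ x ∈ q.2, q.1 a x ∈ q.2) ∧
    primitives K u ⊓ q.2 = ⊥ ∧ primitives K u ⊔ q.2 = augKer K A}

/-- The map `(≺, ≻) ↦ (≺ + ≻, A₊ ≺ A₊)`, where the product `≺ + ≻` of `A₊` is extended to `A` by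
the unit `e`, and `A₊ ≺ A₊` is the linear span of all `a ≺ b` with `a, b ∈ A₊`. -/
def Phi {e : A} (he : IsGroupLikeElem K e)
    (d : (augKer K A →ₗ[K] augKer K A →ₗ[K] augKer K A) ×
      (augKer K A →ₗ[K] augKer K A →ₗ[K] augKer K A)) :
    (A →ₗ[K] A →ₗ[K] A) × Submodule K A :=
  (unitalExt he (d.1 + d.2),
    Submodule.span K {x : A | ∃ a b : augKer K A, x = (d.1 a b : A)})

end CofreeDendriform

end

/-! For a retraction `π` of `A` on `Prim(A)` with `π(e) = 0`, cofreeness makes `a ↦ a₁ ⊗ π(a₂)` an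
isomorphism from `A₊` to `A ⊗ Prim(A)`. For the retraction given by words, its inverse is
concatenation with a last letter. Any other retraction differs from that one by a map `b ⊗ v ↦ b₁ ⊗
g(b₂)v` with `g(e) = id`, which is unipotent for the length of words (`bijective_spread_of_word`,
`IsCofree.exists_inverse_of_retraction`).

Given a dendriform structure, the map `b ⊗ v ↦ v ≺ b` from `A ⊗ Prim(A)` to `A₊` is bijective for
the same reason. As `(v ≺ b) ≺ c = v ≺ (b * c)`, the subspace `A₊ ≺ A₊` corresponds to `A₊ ⊗
Prim(A)`, hence is a complement of `Prim(A)` (`IsDendriformHopf.exists_retraction`). If `π` kills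
this complement, the coproduct formula for `≺` becomes `(a ≺ b)₁ ⊗ π((a ≺ b)₂) = a₁ * b ⊗ π(a₂)`
(`IsDendriformHopf.cofreeMap_left`), so `*` and `A₊ ≺ A₊` determine `≺`, and then `≻`.

Conversely, a pair `(*, I)` gives a retraction `π` with kernel `I` in `A₊`. As `I` is a left ideal,
`A` acts on `Prim(A) ≅ A₊/I` by `v ↦ π(a * v)`. Then `A ⊗ Prim(A)` has a right action `(c ⊗ v) · b =
c * b ⊗ v` and a commuting diagonal left action `a · (c ⊗ v) = a₁ * c ⊗ a₂ v`. Transported to `A₊`,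
they are `≺` and `≻`, with sum `*` because `π(a * b) = a · π(b) + ε(b) π(a)`. -/

noncomputable section

namespace CofreeDendriform

open Coalgebra

/-! ### Words in the tensor algebra -/

section Words

variable {K : Type*} [Field K] {V : Type*} [AddCommGroup V] [Module K V]

@[simp] theorem word_nil : word K ([] : List V) = 1 := by simp [word]

theorem word_cons (v : V) (l : List V) :
    word K (v :: l) = TensorAlgebra.ι K v * word K l := by simp [word]

theorem word_concat (l : List V) (v : V) :
    word K (l ++ [v]) = word K l * TensorAlgebra.ι K v := by simp [word]

variable (K V) in
theorem span_range_word : Submodule.span K (Set.range (word K (V := V))) = ⊤ := by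
  have h := TensorAlgebra.adjoin_range_ι (R := K) (M := V)
  rw [← Algebra.toSubmodule_eq_top, Algebra.adjoin_eq_span] at h
  rw [← h]
  refine le_antisymm (h ▸ le_top) (Submodule.span_mono ?_)
  intro x hx
  obtain ⟨l, hl, rfl⟩ := Submonoid.exists_list_of_mem_closure hx
  have : ∃ l' : List V, l'.map (TensorAlgebra.ι K) = l := by
    rw [← Set.mem_range, Set.range_list_map]
    exact hl
  obtain ⟨l', rfl⟩ := this
  exact ⟨l', rfl⟩

variable (K) in
/-- The projection of `T(V)` on words of length one. -/
def letterProj : TensorAlgebra K V →ₗ[K] V :=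
  letI : Module Kᵐᵒᵖ V := Module.compHom _ ((RingHom.id K).fromOpposite mul_comm)
  haveI : IsCentralScalar K V := ⟨fun _ _ => rfl⟩
  TrivSqZeroExt.sndHom K V ∘ₗ (TensorAlgebra.toTrivSqZeroExt (R := K) (M := V)).toLinearMap

@[simp] theorem letterProj_one : letterProj K (1 : TensorAlgebra K V) = 0 := by
  let _ : Module Kᵐᵒᵖ V := Module.compHom _ ((RingHom.id K).fromOpposite mul_comm)
  have : IsCentralScalar K V := ⟨fun _ _ => rfl⟩
  change TrivSqZeroExt.snd (TensorAlgebra.toTrivSqZeroExt (R := K) (M := V) 1) = 0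
  rw [map_one, TrivSqZeroExt.snd_one]

@[simp] theorem letterProj_ι (v : V) : letterProj K (TensorAlgebra.ι K v) = v := by
  simp [letterProj]

theorem letterProj_word (v w : V) (l : List V) : letterProj K (word K (v :: w :: l)) = 0 := by
  simp [letterProj, word_cons]

end Words

variable {K : Type*} [Field K]

/-- An endomorphism which is unipotent with respect to an exhaustive filtration is bijective. -/
theorem bijective_of_unipotent {X : Type*} [AddCommGroup X] [Module K X] (f : X →ₗ[K] X)
    (G : ℕ → Submodule K X) (h0 : G 0 = ⊥) (hG : ∀ x, ∃ n, x ∈ G n)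
    (hf : ∀ n, ∀ x ∈ G (n + 1), f x - x ∈ G n) : Function.Bijective f := by
  constructor
  · rw [injective_iff_map_eq_zero]
    intro x hx
    obtain ⟨n, hn⟩ := hG x
    induction n with
    | zero => simpa [h0] using hn
    | succ n ih => exact ih (by simpa [hx] using hf n x hn)
  · intro x
    obtain ⟨n, hn⟩ := hG x
    induction n generalizing x with
    | zero => exact ⟨0, by simpa [h0, eq_comm] using hn⟩
    | succ n ih =>
      obtain ⟨y, hy⟩ := ih _ (hf n x hn)
      exact ⟨x - y, by simp [hy]⟩

/-! ### Cofreeness: `A₊ ≅ A ⊗ Prim(A)` for the retraction given by words -/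

section Cofree

variable {A : Type*} [AddCommGroup A] [Module K A] [Coalgebra K A]

section Twist

variable {M : Type*} [AddCommGroup M] [Module K M]

/-- The linear map `a ↦ a₁ ⊗ π(a₂)`. -/
def cofreeMap (π : A →ₗ[K] M) : A →ₗ[K] A ⊗[K] M := π.lTensor A ∘ₗ comul

theorem cofreeMap_apply (π : A →ₗ[K] M) (a : A) : cofreeMap π a = π.lTensor A (comul a) := rfl

/-- The endomorphism `b ⊗ m ↦ b₁ ⊗ g(b₂) m` of `A ⊗ M`. -/
def spread (g : A →ₗ[K] M →ₗ[K] M) : A ⊗[K] M →ₗ[K] A ⊗[K] M :=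
  (TensorProduct.lift g).lTensor A ∘ₗ (TensorProduct.assoc K A A M).toLinearMap ∘ₗ
    (comul (R := K) (A := A)).rTensor M

theorem spread_tmul (g : A →ₗ[K] M →ₗ[K] M) (b : A) (m : M) :
    spread g (b ⊗ₜ m) = (g.flip m).lTensor A (comul b) := by
  simp only [spread, LinearMap.comp_apply, LinearMap.rTensor_tmul, LinearEquiv.coe_coe]
  generalize (comul b : A ⊗[K] A) = t
  induction t with
  | zero => simp
  | add x y hx hy => simp only [TensorProduct.add_tmul, map_add, hx, hy]
  | tmul x y => simp

/-- This is coassociativity with `π` applied to the last factor: `cofreeMap π` is a morphism of left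
comodules to the cofree comodule `A ⊗ M`. -/
theorem coassoc_cofreeMap (π : A →ₗ[K] M) (a : A) :
    (cofreeMap π).lTensor A (comul a) =
      TensorProduct.assoc K A A M ((comul (R := K) (A := A)).rTensor M (cofreeMap π a)) := by
  rw [cofreeMap, LinearMap.lTensor_comp, LinearMap.comp_apply, LinearMap.comp_apply,
    ← coassoc_apply]
  generalize (comul a : A ⊗[K] A) = t
  induction t with
  | zero => simp
  | add x y hx hy => simp only [map_add, hx, hy]
  | tmul x y =>
    simp only [LinearMap.rTensor_tmul, LinearMap.lTensor_tmul]
    generalize (comul x : A ⊗[K] A) = t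
    induction t with
    | zero => simp
    | add x y hx hy => simp only [TensorProduct.add_tmul, map_add, hx, hy]
    | tmul x y => simp

end Twist

/-- If `A` is cofree, the maps `b ⊗ m ↦ b₁ ⊗ g(b₂) m`, where `g` sends the unit to the identity,
are bijective, as they are unipotent with respect to the length of words. -/
theorem bijective_spread_of_word {V : Type*} [AddCommGroup V] [Module K V]
    (φ : TensorAlgebra K V ≃ₗ[K] A)
    (hφ : ∀ l : List V, (comul (φ (word K l)) : A ⊗[K] A) =
      ∑ i ∈ Finset.range (l.length + 1), φ (word K (l.take i)) ⊗ₜ[K] φ (word K (l.drop i)))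
    {M : Type*} [AddCommGroup M] [Module K M] (g : A →ₗ[K] M →ₗ[K] M)
    (hg : g (φ 1) = LinearMap.id) : Function.Bijective (spread g) := by
  -- The strict bound on the length makes `G 0` zero, as the unipotence criterion requires.
  set G : ℕ → Submodule K (A ⊗[K] M) := fun n =>
    Submodule.span K {t | ∃ (l : List V) (m : M), l.length < n ∧ t = φ (word K l) ⊗ₜ m} with hGdef
  have hmono : Monotone G := fun i j hij => Submodule.span_mono
    fun t ⟨l, m, hl, ht⟩ => ⟨l, m, hl.trans_le hij, ht⟩
  refine bijective_of_unipotent _ G ?_ ?_ ?_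
  · simp [hGdef]
  · intro t
    induction t with
    | zero => exact ⟨0, zero_mem _⟩
    | add x y hx hy =>
      obtain ⟨i, hi⟩ := hx
      obtain ⟨j, hj⟩ := hy
      exact ⟨max i j, add_mem (hmono (le_max_left _ _) hi) (hmono (le_max_right _ _) hj)⟩
    | tmul b m =>
      obtain ⟨x, rfl⟩ := φ.surjective b
      have hx : x ∈ Submodule.span K (Set.range (word K (V := V))) := by simp [span_range_word]
      induction hx using Submodule.span_induction with
      | mem x hx =>
        obtain ⟨l, rfl⟩ := hx
        exact ⟨l.length + 1, Submodule.subset_span ⟨l, m, by simp, rfl⟩⟩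
      | zero => exact ⟨0, by simp⟩
      | add x y _ _ hx hy =>
        obtain ⟨i, hi⟩ := hx
        obtain ⟨j, hj⟩ := hy
        refine ⟨max i j, ?_⟩
        rw [map_add, TensorProduct.add_tmul]
        exact add_mem (hmono (le_max_left _ _) hi) (hmono (le_max_right _ _) hj)
      | smul c x _ hx =>
        obtain ⟨i, hi⟩ := hx
        refine ⟨i, ?_⟩
        rw [map_smul, ← TensorProduct.smul_tmul']
        exact Submodule.smul_mem _ _ hi
  · intro n t ht
    induction ht using Submodule.span_induction with
    | mem t ht =>
      obtain ⟨l, m, hl, rfl⟩ := ht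
      -- The last cut leaves the empty word on the right, where `g` is the identity; it reproduces
      -- `t`. All other cuts have a strictly shorter prefix.
      rw [spread_tmul, hφ, Finset.sum_range_succ]
      simp only [List.take_length, List.drop_length, word_nil, map_add, LinearMap.lTensor_tmul,
        LinearMap.flip_apply, hg, LinearMap.id_apply, add_sub_cancel_right, map_sum]
      refine sum_mem fun i hi => Submodule.subset_span ⟨l.take i, _, ?_, rfl⟩
      simp only [Finset.mem_range] at hi
      simp only [List.length_take]
      omega
    | zero => simp
    | add x y _ _ hx hy =>
      rw [map_add, add_sub_add_comm]
      exact add_mem hx hy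
    | smul c x _ hx =>
      rw [map_smul, ← smul_sub]
      exact Submodule.smul_mem _ _ hx

/-- A group-like element is unique if the maps `b ↦ g(b₂) b₁` with `g(e) = 1` are injective. -/
theorem groupLike_unique {e x : A}
    (hinj : ∀ g : A →ₗ[K] K →ₗ[K] K, g e = LinearMap.id → Function.Injective (spread g))
    (hx : IsGroupLikeElem K x) (he : IsGroupLikeElem K e) : x = e := by
  by_cases hex : e ∈ Submodule.span K {x}
  · obtain ⟨c, hc⟩ := Submodule.mem_span_singleton.1 hex
    have h := he.counit_eq_one
    rw [← hc, map_smul, hx.counit_eq_one, smul_eq_mul, mul_one] at h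
    rw [← hc, h, one_smul]
  · exfalso
    -- A functional with `f(x) = 0` and `f(e) ≠ 0`, normalised at `e`, gives a map that should be
    -- injective but sends `x ⊗ 1` to `x ⊗ f(x)/f(e) = 0`.
    obtain ⟨f, hfe, hf⟩ := Submodule.exists_le_ker_of_notMem hex
    have hfx : f x = 0 := hf (Submodule.mem_span_singleton_self x)
    have h0 : x ⊗ₜ[K] (1 : K) = 0 := by
      refine (injective_iff_map_eq_zero _).1
        (hinj ((f e)⁻¹ • LinearMap.lsmul K K ∘ₗ f) ?_) _ ?_
      · ext; simp [hfe]
      · rw [spread_tmul, hx.comul_eq_tmul_self]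
        simp [hfx]
    have h1 := congrArg ((TensorProduct.lid K K).toLinearMap ∘ₗ (counit (R := K) (A := A)).rTensor K) h0
    simp [hx.counit_eq_one] at h1

/-- In a cofree coalgebra, there is an isomorphism with words sending the empty word to a given
group-like element. -/
theorem IsCofree.exists_equiv {A : Type v} [AddCommGroup A] [Module K A] [Coalgebra K A]
    (hA : IsCofree K A) {e : A} (he : IsGroupLikeElem K e) :
    ∃ (V : Type v) (_ : AddCommGroup V) (_ : Module K V) (φ : TensorAlgebra K V ≃ₗ[K] A),
    (∀ l : List V, (comul (φ (word K l)) : A ⊗[K] A) =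
      ∑ i ∈ Finset.range (l.length + 1), φ (word K (l.take i)) ⊗ₜ[K] φ (word K (l.drop i))) ∧
    (∀ v : V, ∀ l : List V, counit (R := K) (φ (word K (v :: l))) = 0) ∧ φ 1 = e := by
  obtain ⟨V, _, _, φ, hφ, hε, h1⟩ := hA
  refine ⟨V, _, _, φ, hφ, hε, Eq.symm ?_⟩
  refine groupLike_unique (fun g hg => (bijective_spread_of_word φ hφ g hg).1) he ⟨?_, ?_⟩
  · simpa using h1
  · simpa using hφ []

theorem IsCofree.bijective_spread {A : Type v} [AddCommGroup A] [Module K A] [Coalgebra K A]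
    (hA : IsCofree K A) {e : A} (he : IsGroupLikeElem K e)
    {M : Type*} [AddCommGroup M] [Module K M] (g : A →ₗ[K] M →ₗ[K] M)
    (hg : g e = LinearMap.id) : Function.Bijective (spread g) := by
  obtain ⟨V, _, _, φ, hφ, -, rfl⟩ := hA.exists_equiv he
  exact bijective_spread_of_word φ hφ g hg

theorem IsCofree.groupLike_unique {A : Type v} [AddCommGroup A] [Module K A] [Coalgebra K A]
    (hA : IsCofree K A) {e x : A} (he : IsGroupLikeElem K e) (hx : IsGroupLikeElem K x) :
    x = e :=
  CofreeDendriform.groupLike_unique (fun g hg => (hA.bijective_spread he g hg).1) hx he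

theorem mem_primitives {u x : A} :
    x ∈ primitives K u ↔ comul x = x ⊗ₜ[K] u + u ⊗ₜ[K] x := Iff.rfl

theorem counit_eq_zero_of_mem_primitives {e x : A} (he : IsGroupLikeElem K e)
    (hx : x ∈ primitives K e) : counit (R := K) x = 0 := by
  have h := rTensor_counit_comul (R := K) x
  rw [mem_primitives.1 hx] at h
  have h1 := congrArg ((TensorProduct.lid K K).toLinearMap ∘ₗ (counit (R := K) (A := A)).lTensor K) h
  simpa [he.counit_eq_one] using h1

theorem cofreeMap_of_mem_primitives {M : Type*} [AddCommGroup M] [Module K M] {e x : A}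
    {π : A →ₗ[K] M} (hπ : π e = 0) (hx : x ∈ primitives K e) : cofreeMap π x = e ⊗ₜ π x := by
  simp [cofreeMap_apply, mem_primitives.1 hx, hπ]

/-- `Ψ` is an inverse of `a ↦ a₁ ⊗ π(a₂)`, seen as a map from `A₊` to `A ⊗ M`. -/
structure IsCofreeInverse {M : Type*} [AddCommGroup M] [Module K M] (e : A) (π : A →ₗ[K] M)
    (Ψ : A ⊗[K] M →ₗ[K] A) : Prop where
  right_inv : ∀ t, cofreeMap π (Ψ t) = t
  left_inv : ∀ a, Ψ (cofreeMap π a) = a - counit (R := K) a • e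

/-- The retraction `π` of `A` on its primitive elements which is induced by a description of `A`
by words, and the associated inverse, which is the concatenation. -/
theorem IsCofree.exists_inverse {A : Type v} [AddCommGroup A] [Module K A] [Coalgebra K A]
    (hA : IsCofree K A) {e : A} (he : IsGroupLikeElem K e) :
    ∃ (π : A →ₗ[K] primitives K e) (Ψ : A ⊗[K] primitives K e →ₗ[K] A),
      π e = 0 ∧ (∀ v : primitives K e, π v = v) ∧ IsCofreeInverse e π Ψ := by
  obtain ⟨V, _, _, φ, hφ, hε, rfl⟩ := hA.exists_equiv he
  have hprim (v : V) : φ (TensorAlgebra.ι K v) ∈ primitives K (φ 1) := by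
    have := hφ [v]
    simp only [word, List.map_cons, List.map_nil, List.prod_cons, List.prod_nil, mul_one,
      List.length_cons, List.length_nil, zero_add, Finset.sum_range_succ, Finset.range_zero,
      Finset.sum_empty, List.take_zero, List.drop_zero, List.take_succ_cons,
      List.drop_succ_cons] at this
    rw [mem_primitives, this, add_comm]
  set ψ : V →ₗ[K] primitives K (φ 1) :=
    LinearMap.codRestrict _ (φ.toLinearMap ∘ₗ TensorAlgebra.ι K) hprim with hψ
  set π : A →ₗ[K] primitives K (φ 1) := ψ ∘ₗ letterProj K ∘ₗ φ.symm.toLinearMap with hπ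
  set Ψ : A ⊗[K] primitives K (φ 1) →ₗ[K] A := φ.toLinearMap ∘ₗ
    LinearMap.mul' K (TensorAlgebra K V) ∘ₗ
      TensorProduct.map φ.symm.toLinearMap (φ.symm.toLinearMap ∘ₗ Submodule.subtype _) with hΨ
  have hΨψ (x : TensorAlgebra K V) (v : V) :
      Ψ (φ x ⊗ₜ ψ v) = φ (x * TensorAlgebra.ι K v) := by simp [hΨ, hψ]
  have hπφ (x : TensorAlgebra K V) : π (φ x) = ψ (letterProj K x) :=
    congrArg (fun y => ψ (letterProj K y)) (φ.symm_apply_apply x)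
  have hπ1 : π (φ 1) = 0 := by simp [hπφ]
  have hπψ (v : V) : π (ψ v) = ψ v := by
    change π (φ _) = _
    simp [hπφ]
  -- Only the cut just before the last letter survives, since `π` kills the empty word and all words
  -- of length at least two.
  have hconcat (l : List V) (v : V) :
      cofreeMap π (φ (word K (l ++ [v]))) = φ (word K l) ⊗ₜ ψ v := by
    rw [cofreeMap_apply, hφ, map_sum, Finset.sum_eq_single_of_mem l.length (by simp)]
    · simp [hπφ, word_cons]
    · intro i hi hil
      simp only [Finset.mem_range, List.length_append, List.length_singleton] at hi
      suffices h : π (φ (word K ((l ++ [v]).drop i))) = 0 by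
        rw [LinearMap.lTensor_tmul, h, TensorProduct.tmul_zero]
      rcases lt_or_gt_of_ne hil with h | h
      · have h2 : 2 ≤ ((l ++ [v]).drop i).length := by simp; omega
        match hm : (l ++ [v]).drop i, h2 with
        | a :: b :: k, _ => simp [hπφ, letterProj_word]
      · obtain rfl : i = (l ++ [v]).length := by simp; omega
        simpa using hπ1
  have hl (a : A) : Ψ (cofreeMap π a) = a - counit (R := K) a • φ 1 := by
    obtain ⟨x, rfl⟩ := φ.surjective a
    have hx : x ∈ Submodule.span K (Set.range (word K (V := V))) := by simp [span_range_word]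
    induction hx using Submodule.span_induction with
    | mem x hx =>
      obtain ⟨l, rfl⟩ := hx
      rcases l.eq_nil_or_concat with rfl | ⟨k, v, rfl⟩
      · simp [cofreeMap_apply, he.comul_eq_tmul_self, hπ1, he.counit_eq_one]
      · rw [List.concat_eq_append, hconcat, hΨψ, ← word_concat]
        have : counit (R := K) (φ (word K (k ++ [v]))) = 0 := by
          cases k with
          | nil => exact hε _ _
          | cons w k => exact hε _ _
        simp [this]
    | zero => simp
    | add x y _ _ hx hy =>
      simp only [map_add, hx, hy]
      module
    | smul c x _ hx =>
      simp only [map_smul, hx, smul_eq_mul]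
      module
  -- Every primitive element is a letter: it equals `Ψ(1 ⊗ π(p))`, the concatenation of the empty
  -- word with a letter.
  have hsurj (p : primitives K (φ 1)) : ∃ v, ψ v = p := by
    have h := hl p
    rw [cofreeMap_of_mem_primitives hπ1 p.2, counit_eq_zero_of_mem_primitives he p.2, zero_smul,
      sub_zero] at h
    refine ⟨letterProj K (φ.symm p), Subtype.ext ?_⟩
    refine Eq.trans ?_ h
    change _ = Ψ (_ ⊗ₜ ψ _)
    rw [hΨψ, one_mul]
    rfl
  refine ⟨π, Ψ, hπ1, fun p => ?_, fun t => ?_, hl⟩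
  · obtain ⟨v, rfl⟩ := hsurj p
    exact hπψ v
  · induction t with
    | zero => simp
    | add x y hx hy => simp only [map_add, hx, hy]
    | tmul a p =>
      obtain ⟨v, rfl⟩ := hsurj p
      obtain ⟨x, rfl⟩ := φ.surjective a
      have hx : x ∈ Submodule.span K (Set.range (word K (V := V))) := by simp [span_range_word]
      induction hx using Submodule.span_induction with
      | mem x hx =>
        obtain ⟨l, rfl⟩ := hx
        rw [hΨψ, ← word_concat, hconcat]
      | zero => simp
      | add x y _ _ hx hy => simp only [map_add, TensorProduct.add_tmul, hx, hy]
      | smul c x _ hx => simp only [map_smul, ← TensorProduct.smul_tmul', hx]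

end Cofree

/-! ### Change of retraction -/

section Inverse

variable {A : Type*} [AddCommGroup A] [Module K A] [Coalgebra K A]
  {M N : Type*} [AddCommGroup M] [Module K M] [AddCommGroup N] [Module K N] {e : A}

theorem IsCofreeInverse.counit_apply {π : A →ₗ[K] M} {Ψ : A ⊗[K] M →ₗ[K] A}
    (h : IsCofreeInverse e π Ψ) (he : IsGroupLikeElem K e) (t : A ⊗[K] M) :
    counit (R := K) (Ψ t) = 0 := by
  have h1 := congrArg (counit (R := K)) (h.left_inv (Ψ t))
  rw [h.right_inv] at h1
  simpa [he.counit_eq_one] using h1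

theorem IsCofreeInverse.apply_unit_tmul {π : A →ₗ[K] M} {Ψ : A ⊗[K] M →ₗ[K] A}
    (h : IsCofreeInverse e π Ψ) (he : IsGroupLikeElem K e) (hπ : π e = 0) {x : A}
    (hx : x ∈ primitives K e) : Ψ (e ⊗ₜ π x) = x := by
  rw [← cofreeMap_of_mem_primitives hπ hx, h.left_inv, counit_eq_zero_of_mem_primitives he hx,
    zero_smul, sub_zero]

theorem IsCofreeInverse.comp_apply {π : A →ₗ[K] M} {Ψ : A ⊗[K] M →ₗ[K] A}
    (h : IsCofreeInverse e π Ψ) {ρ : A →ₗ[K] N} (hρ : ρ e = 0) :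
    ρ = ρ ∘ₗ Ψ ∘ₗ cofreeMap π := by
  ext a
  simp [h.left_inv, hρ]

/-- Since `ρ` factors as `(ρ ∘ Ψ) ∘ cofreeMap π`, coassociativity expresses `cofreeMap ρ` through
`cofreeMap π`. The comparison map is a `spread`, so it is bijective as soon as `ρ ∘ Ψ` is the
identity on `e ⊗ M` and `A` is cofree. -/
theorem IsCofreeInverse.cofreeMap_apply {π ρ : A →ₗ[K] M} {Ψ : A ⊗[K] M →ₗ[K] A}
    (h : IsCofreeInverse e π Ψ) (hρ : ρ e = 0) (t : A ⊗[K] M) :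
    cofreeMap ρ (Ψ t) = spread (TensorProduct.curry (ρ ∘ₗ Ψ)) t := by
  rw [CofreeDendriform.cofreeMap_apply]
  conv_lhs => rw [h.comp_apply hρ, ← LinearMap.comp_assoc, LinearMap.lTensor_comp,
    LinearMap.comp_apply, coassoc_cofreeMap, h.right_inv]
  simp only [spread, LinearMap.comp_apply, LinearEquiv.coe_coe]
  congr 2
  ext
  simp

end Inverse

/-- In a cofree coalgebra `A`, for every retraction `π` of `A` on its primitive elements which
vanishes on the unit, `a ↦ a₁ ⊗ π(a₂)` is an isomorphism from `A₊` to `A ⊗ Prim(A)`. -/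
theorem IsCofree.exists_inverse_of_retraction
    {A : Type v} [AddCommGroup A] [Module K A] [Coalgebra K A]
    (hA : IsCofree K A) {e : A} (he : IsGroupLikeElem K e) {π : A →ₗ[K] primitives K e}
    (hπ : π e = 0) (hπv : ∀ v : primitives K e, π v = v) : ∃ Ψ, IsCofreeInverse e π Ψ := by
  obtain ⟨π₀, Ψ₀, h0, hv0, h⟩ := hA.exists_inverse he
  have hU : Function.Bijective (spread (TensorProduct.curry (π ∘ₗ Ψ₀))) := by
    refine hA.bijective_spread he _ (LinearMap.ext fun v => ?_)
    have := h.apply_unit_tmul he h0 v.2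
    rw [hv0] at this
    simp [this, hπv]
  -- The kernel of `cofreeMap π` is spanned by `e`. With the right inverse `Ψ₀ ∘ U⁻¹`, this gives
  -- the left inverse property too.
  have hinj (x : A) (hx : cofreeMap π x = 0) : x = counit (R := K) x • e := by
    have h1 := h.left_inv x
    have h2 : cofreeMap π (Ψ₀ (cofreeMap π₀ x)) = 0 := by
      rw [h1, map_sub, hx, map_smul]
      simp [cofreeMap_apply, he.comul_eq_tmul_self, hπ]
    rw [h.cofreeMap_apply hπ] at h2
    rw [(injective_iff_map_eq_zero _).1 hU.1 _ h2, map_zero, eq_comm, sub_eq_zero] at h1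
    exact h1
  set U := LinearEquiv.ofBijective _ hU
  have hr (t) : cofreeMap π (Ψ₀ (U.symm t)) = t := by
    rw [h.cofreeMap_apply hπ]
    exact U.apply_symm_apply t
  refine ⟨Ψ₀ ∘ₗ U.symm.toLinearMap, hr, fun a => ?_⟩
  have h1 := hinj (Ψ₀ (U.symm (cofreeMap π a)) - a) (by rw [map_sub, hr, sub_self])
  rw [map_sub, h.counit_apply he] at h1
  simp only [LinearMap.comp_apply, LinearEquiv.coe_coe]
  rw [sub_eq_iff_eq_add.1 h1]
  module

/-! ### Splitting `A = A₊ ⊕ K e` and the reduced coproduct -/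

section Unital

variable {A : Type*} [AddCommGroup A] [Module K A] [Coalgebra K A] {e : A}

theorem coe_augProj (he : IsGroupLikeElem K e) (a : A) :
    (augProj he a : A) = a - counit (R := K) a • e := rfl

@[simp] theorem augProj_unit (he : IsGroupLikeElem K e) : augProj he e = 0 :=
  Subtype.ext (by simp [coe_augProj, he.counit_eq_one])

@[simp] theorem counit_coe (a : augKer K A) : counit (R := K) (a : A) = 0 := a.2

@[simp] theorem augProj_coe (he : IsGroupLikeElem K e) (a : augKer K A) : augProj he a = a :=
  Subtype.ext (by simp [coe_augProj])

theorem augProj_add (he : IsGroupLikeElem K e) (a : A) :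
    a = augProj he a + counit (R := K) a • e := by simp [coe_augProj]

theorem unitalExt_apply (he : IsGroupLikeElem K e)
    (m : augKer K A →ₗ[K] augKer K A →ₗ[K] augKer K A) (a b : A) :
    unitalExt he m a b = (counit (R := K) a * counit (R := K) b) • e
      + counit (R := K) a • (augProj he b : A) + counit (R := K) b • (augProj he a : A)
      + (m (augProj he a) (augProj he b) : A) := rfl

@[simp] theorem unitalExt_coe_coe (he : IsGroupLikeElem K e)
    (m : augKer K A →ₗ[K] augKer K A →ₗ[K] augKer K A) (a b : augKer K A) :
    unitalExt he m a b = m a b := by simp [unitalExt_apply]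

@[simp] theorem unitalExt_unit_left (he : IsGroupLikeElem K e)
    (m : augKer K A →ₗ[K] augKer K A →ₗ[K] augKer K A) (b : A) : unitalExt he m e b = b := by
  simp [unitalExt_apply, he.counit_eq_one, coe_augProj]

@[simp] theorem unitalExt_unit_right (he : IsGroupLikeElem K e)
    (m : augKer K A →ₗ[K] augKer K A →ₗ[K] augKer K A) (a : A) : unitalExt he m a e = a := by
  simp [unitalExt_apply, he.counit_eq_one, coe_augProj]

theorem comul_coe (he : IsGroupLikeElem K e) (a : augKer K A) :
    comul (a : A) = TensorProduct.map (augKer K A).subtype (augKer K A).subtype (redComul he a)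
      + (a : A) ⊗ₜ[K] e + e ⊗ₜ[K] (a : A) := by
  rw [map_subtype_redComul]
  abel

/-- Identities between reduced coproducts can thus be checked in `A ⊗ A`, where the full coproduct
is available. -/
theorem map_subtype_injective : Function.Injective
    (TensorProduct.map (augKer K A).subtype (augKer K A).subtype) :=
  TensorProduct.map_injective_of_flat_flat _ _ (Submodule.subtype_injective _)
    (Submodule.subtype_injective _)

variable (K A) in
theorem primitives_le_augKer (he : IsGroupLikeElem K e) : primitives K e ≤ augKer K A :=
  fun _ hx => counit_eq_zero_of_mem_primitives he hx

theorem redComul_of_mem_primitives (he : IsGroupLikeElem K e) (a : augKer K A)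
    (ha : (a : A) ∈ primitives K e) : redComul he a = 0 := by
  refine map_subtype_injective ?_
  rw [map_subtype_redComul, mem_primitives.1 ha]
  simp

end Unital

/-! ### From a dendriform structure to a complement of the primitive elements -/

section Dendriform

variable {A : Type*} [AddCommGroup A] [Module K A] [Coalgebra K A] {e : A}
  {he : IsGroupLikeElem K e} {p s : augKer K A →ₗ[K] augKer K A →ₗ[K] augKer K A}

variable (he p) in
/-- The map `A ⊗ Prim(A) → A`, `b ⊗ v ↦ v ≺ b`, where `v ≺ 1 = v`. -/
def primLeft : A ⊗[K] primitives K e →ₗ[K] A :=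
  TensorProduct.lift <| LinearMap.mk₂ K
    (fun b v => (p (Submodule.inclusion (primitives_le_augKer K A he) v) (augProj he b) : A)
      + counit (R := K) b • (v : A))
    (fun _ _ _ => by simp only [map_add, Submodule.coe_add]; module)
    (fun _ _ _ => by simp only [map_smul, Submodule.coe_smul, smul_eq_mul]; module)
    (fun _ _ _ => by simp only [map_add, LinearMap.add_apply, Submodule.coe_add]; module)
    (fun _ _ _ => by simp only [map_smul, LinearMap.smul_apply, Submodule.coe_smul]; module)

theorem primLeft_tmul (b : A) (v : primitives K e) :
    primLeft he p (b ⊗ₜ v) =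
      (p (Submodule.inclusion (primitives_le_augKer K A he) v) (augProj he b) : A)
        + counit (R := K) b • (v : A) := rfl

theorem primLeft_unit_tmul (v : primitives K e) : primLeft he p (e ⊗ₜ v) = v := by
  simp [primLeft_tmul, he.counit_eq_one]

theorem primLeft_coe_tmul (b : augKer K A) (v : primitives K e) : primLeft he p ((b : A) ⊗ₜ v) =
    p (Submodule.inclusion (primitives_le_augKer K A he) v) b := by
  simp [primLeft_tmul]

theorem counit_primLeft (t : A ⊗[K] primitives K e) : counit (R := K) (primLeft he p t) = 0 := by
  induction t with
  | zero => simp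
  | add x y hx hy => simp [hx, hy]
  | tmul b v => simp [primLeft_tmul, counit_eq_zero_of_mem_primitives he v.2]

/-- Since the reduced coproduct of `v` vanishes, the formula for `v ≺ b` keeps only `b' ⊗ v ≺ b''`
and `b ⊗ v`, that is `Δ(v ≺ b) = b₁ ⊗ v ≺ b₂ + (v ≺ b) ⊗ e` with `v ≺ e = v`. -/
theorem IsDendriformHopf.comul_primLeft_tmul (h : IsDendriformHopf he p s) (b : A)
    (v : primitives K e) : comul (primLeft he p (b ⊗ₜ v)) =
      ((TensorProduct.curry (primLeft he p)).flip v).lTensor A (comul b)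
        + primLeft he p (b ⊗ₜ v) ⊗ₜ e := by
  suffices H : ∀ b : augKer K A, comul (primLeft he p ((b : A) ⊗ₜ v)) =
      ((TensorProduct.curry (primLeft he p)).flip v).lTensor A (comul (b : A))
        + primLeft he p ((b : A) ⊗ₜ v) ⊗ₜ e by
    rw [augProj_add he b]
    simp only [TensorProduct.add_tmul, map_add, ← TensorProduct.smul_tmul', map_smul, H,
      primLeft_unit_tmul, he.comul_eq_tmul_self, LinearMap.lTensor_tmul, LinearMap.flip_apply,
      TensorProduct.curry_apply, mem_primitives.1 v.2, smul_add]
    abel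
  intro b
  rw [primLeft_coe_tmul, comul_coe he, h.redComul_left, redComul_of_mem_primitives he _ v.2,
    comul_coe he b]
  simp only [map_zero, LinearMap.zero_apply, zero_add, add_zero, map_add, TensorProduct.map_tmul,
    LinearMap.lTensor_tmul, LinearMap.flip_apply, TensorProduct.curry_apply, primLeft_unit_tmul,
    primLeft_coe_tmul, Submodule.subtype_apply, Submodule.coe_inclusion]
  have : TensorProduct.map (augKer K A).subtype (augKer K A).subtype
      ((p (Submodule.inclusion (primitives_le_augKer K A he) v)).lTensor _ (redComul he b)) =
      ((TensorProduct.curry (primLeft he p)).flip v).lTensor A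
        (TensorProduct.map (augKer K A).subtype (augKer K A).subtype (redComul he b)) := by
    generalize redComul he b = t
    induction t with
    | zero => simp
    | add x y hx hy => simp only [map_add, hx, hy]
    | tmul x y => simp [primLeft_coe_tmul]
  rw [this]
  abel

/-- The retraction on the primitive elements with kernel `A₊ ≺ A₊`. -/
theorem IsDendriformHopf.exists_retraction
    {A : Type v} [AddCommGroup A] [Module K A] [Coalgebra K A] (hA : IsCofree K A) {e : A}
    {he : IsGroupLikeElem K e} {p s : augKer K A →ₗ[K] augKer K A →ₗ[K] augKer K A}
    (h : IsDendriformHopf he p s) :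
    ∃ π : A →ₗ[K] primitives K e, π e = 0 ∧ (∀ v : primitives K e, π v = v) ∧
      (∀ a b, π (p a b) = 0) ∧
      augKer K A ≤ primitives K e ⊔ Submodule.span K {x : A | ∃ a b, x = (p a b : A)} := by
  obtain ⟨π₀, Ψ₀, h0, hv0, hΨ⟩ := hA.exists_inverse he
  have hspread (t) : cofreeMap π₀ (primLeft he p t) =
      spread (TensorProduct.curry (π₀ ∘ₗ primLeft he p)) t := by
    induction t with
    | zero => simp
    | add x y hx hy => simp only [map_add, hx, hy]
    | tmul b v =>
      rw [cofreeMap_apply, h.comul_primLeft_tmul, spread_tmul, map_add, LinearMap.lTensor_tmul,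
        h0, TensorProduct.tmul_zero, add_zero, ← LinearMap.comp_apply, ← LinearMap.lTensor_comp]
      rfl
  have hU : Function.Bijective (spread (TensorProduct.curry (π₀ ∘ₗ primLeft he p))) := by
    refine hA.bijective_spread he _ (LinearMap.ext fun v => ?_)
    simp [primLeft_unit_tmul, hv0]
  have hsurj (a : augKer K A) : ∃ t, primLeft he p t = a := by
    obtain ⟨t, ht⟩ := hU.2 (cofreeMap π₀ a)
    refine ⟨t, ?_⟩
    have h1 := hΨ.left_inv (primLeft he p t)
    rw [hspread, ht, hΨ.left_inv, counit_primLeft, counit_coe] at h1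
    simpa using h1.symm
  set U := LinearEquiv.ofBijective _ hU
  -- This is `v ≺ b ↦ ε(b) v`, read through the isomorphism `b ⊗ v ↦ v ≺ b`.
  set π : A →ₗ[K] primitives K e := (TensorProduct.lid K _).toLinearMap ∘ₗ
    (counit (R := K) (A := A)).rTensor _ ∘ₗ U.symm.toLinearMap ∘ₗ cofreeMap π₀ with hπ
  have hπL (b : A) (v : primitives K e) :
      π (primLeft he p (b ⊗ₜ v)) = counit (R := K) b • v := by
    have : U.symm (spread (TensorProduct.curry (π₀ ∘ₗ primLeft he p)) (b ⊗ₜ v)) = b ⊗ₜ v :=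
      U.symm_apply_apply _
    simp [hπ, hspread, this]
  have hp (b : augKer K A) (v : primitives K e) : π (p (Submodule.inclusion
      (primitives_le_augKer K A he) v) b) = 0 := by
    rw [← primLeft_coe_tmul (he := he), hπL, counit_coe, zero_smul]
  refine ⟨π, ?_, fun v => ?_, fun a b => ?_, ?_⟩
  · simp [hπ, cofreeMap_apply, he.comul_eq_tmul_self, h0]
  · conv_lhs => rw [← primLeft_unit_tmul (he := he) (p := p) v]
    rw [hπL, he.counit_eq_one, one_smul]
  · obtain ⟨t, ht⟩ := hsurj a
    -- Writing `a` as a sum of terms `v ≺ c`, the axiom `(v ≺ c) ≺ b = v ≺ (c * b)` reduces the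
    -- claim to a primitive left factor.
    have key : ∀ t, π (p (augProj he (primLeft he p t)) b) = 0 := by
      intro t
      induction t with
      | zero => simp
      | add x y hx hy => simp [hx, hy]
      | tmul c v =>
        have hv : augProj he (v : A) = Submodule.inclusion (primitives_le_augKer K A he) v :=
          augProj_coe he (Submodule.inclusion (primitives_le_augKer K A he) v)
        rw [primLeft_tmul]
        simp only [map_add, map_smul, augProj_coe, hv, LinearMap.add_apply, LinearMap.smul_apply,
          Submodule.coe_add, Submodule.coe_smul, h.left_left, hp, smul_zero, zero_add]
    simpa [ht] using key t
  · intro x hx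
    obtain ⟨t, ht⟩ := hsurj ⟨x, hx⟩
    change primLeft he p t = x at ht
    rw [← ht]
    clear ht
    induction t with
    | zero => simp
    | add x y hx hy => simpa using add_mem hx hy
    | tmul b v =>
      rw [primLeft_tmul, add_comm]
      exact Submodule.add_mem_sup (Submodule.smul_mem _ _ v.2)
        (Submodule.subset_span ⟨_, _, rfl⟩)

/-- In the coproduct of `a ≺ b`, `π` kills each term whose right factor is `e` or lies in `A₊ ≺ A₊`.
What remains, `a' * b ⊗ π(a'') + b ⊗ π(a)`, is right multiplication by `b` on `a₁ ⊗ π(a₂)`. -/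
theorem IsDendriformHopf.cofreeMap_left (h : IsDendriformHopf he p s) {M : Type*}
    [AddCommGroup M] [Module K M] {π : A →ₗ[K] M} (h0 : π e = 0)
    (hπ : ∀ a b, π (p a b) = 0) (a b : augKer K A) :
    cofreeMap π (p a b) =
      ((unitalExt he (p + s)).flip b).rTensor M (cofreeMap π a) := by
  rw [cofreeMap_apply, cofreeMap_apply, comul_coe he, comul_coe he a, h.redComul_left]
  have h1 (x y : augKer K A ⊗[K] augKer K A) : π.lTensor A
      (TensorProduct.map (augKer K A).subtype (augKer K A).subtype
        (TensorProduct.map₂ (p + s) p x y)) = 0 := by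
    induction x with
    | zero => simp
    | add x y hx hy => simp only [map_add, LinearMap.add_apply, hx, hy, add_zero]
    | tmul x x' =>
      induction y with
      | zero => simp
      | add x y hx hy => simp only [map_add, hx, hy, add_zero]
      | tmul y y' => simp [hπ]
  have h2 (x : augKer K A ⊗[K] augKer K A) : π.lTensor A
      (TensorProduct.map (augKer K A).subtype (augKer K A).subtype
        ((p a).lTensor (augKer K A) x)) = 0 := by
    induction x with
    | zero => simp
    | add x y hx hy => simp only [map_add, hx, hy, add_zero]
    | tmul x x' => simp [hπ]
  have h3 (x : augKer K A ⊗[K] augKer K A) : π.lTensor A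
      (TensorProduct.map (augKer K A).subtype (augKer K A).subtype
        ((p.flip b).lTensor (augKer K A) x)) = 0 := by
    induction x with
    | zero => simp
    | add x y hx hy => simp only [map_add, hx, hy, add_zero]
    | tmul x x' => simp [hπ]
  have h4 (x : augKer K A ⊗[K] augKer K A) : π.lTensor A
      (TensorProduct.map (augKer K A).subtype (augKer K A).subtype
        (((p + s).flip b).rTensor (augKer K A) x)) =
      ((unitalExt he (p + s)).flip b).rTensor M (π.lTensor A
        (TensorProduct.map (augKer K A).subtype (augKer K A).subtype x)) := by
    induction x with
    | zero => simp
    | add x y hx hy => simp only [map_add, hx, hy]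
    | tmul x x' =>
      simp only [LinearMap.rTensor_tmul, LinearMap.lTensor_tmul, TensorProduct.map_tmul,
        LinearMap.flip_apply, Submodule.subtype_apply, unitalExt_coe_coe]
  simp only [map_add, h1, h2, h3, h4, LinearMap.lTensor_tmul, LinearMap.rTensor_tmul,
    TensorProduct.map_tmul, h0, hπ, TensorProduct.tmul_zero, LinearMap.flip_apply,
    unitalExt_unit_left, Submodule.subtype_apply, zero_add, add_zero]

end Dendriform

/-! ### From a left action on `M` to the two half-products -/

section Construction

variable {A : Type*} [AddCommGroup A] [Module K A]
  {M : Type*} [AddCommGroup M] [Module K M]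

/-- The right action of `A` on `A ⊗ M`, `(a ⊗ v) · b = m(a, b) ⊗ v`. -/
def rightAct (M : Type*) [AddCommGroup M] [Module K M] (m : A →ₗ[K] A →ₗ[K] A) :
    A ⊗[K] M →ₗ[K] A →ₗ[K] A ⊗[K] M :=
  (LinearMap.rTensorHom M ∘ₗ m.flip).flip

theorem rightAct_apply (m : A →ₗ[K] A →ₗ[K] A) (t : A ⊗[K] M) (b : A) :
    rightAct M m t b = (m.flip b).rTensor M t := rfl

@[simp] theorem rightAct_tmul (m : A →ₗ[K] A →ₗ[K] A) (a : A) (v : M) (b : A) :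
    rightAct M m (a ⊗ₜ v) b = m a b ⊗ₜ v := rfl

variable [Coalgebra K A] {e : A}

/-- The diagonal left action of `A` on `A ⊗ M`, `a · (b ⊗ v) = m(a₁, b) ⊗ a₂ v`. -/
def diagAct (m : A →ₗ[K] A →ₗ[K] A) (act : A →ₗ[K] M →ₗ[K] M) :
    A →ₗ[K] A ⊗[K] M →ₗ[K] A ⊗[K] M :=
  TensorProduct.map₂ m act ∘ₗ comul

theorem diagAct_apply (m : A →ₗ[K] A →ₗ[K] A) (act : A →ₗ[K] M →ₗ[K] M) (a : A)
    (t : A ⊗[K] M) : diagAct m act a t = TensorProduct.map₂ m act (comul a) t := rfl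

/-- The left product, obtained from the right action by the isomorphism of `A₊` and `A ⊗ M`. -/
def leftProd (m : A →ₗ[K] A →ₗ[K] A) (π : A →ₗ[K] M) (Ψ : A ⊗[K] M →ₗ[K] A) :
    A →ₗ[K] A →ₗ[K] A :=
  (rightAct M m ∘ₗ cofreeMap π).compr₂ Ψ

theorem leftProd_apply (m : A →ₗ[K] A →ₗ[K] A) (π : A →ₗ[K] M) (Ψ : A ⊗[K] M →ₗ[K] A)
    (a b : A) : leftProd m π Ψ a b = Ψ (rightAct M m (cofreeMap π a) b) := rfl

/-- The right product, obtained from the left action by the isomorphism of `A₊` and `A ⊗ M`. -/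
def rightProd (m : A →ₗ[K] A →ₗ[K] A) (π : A →ₗ[K] M) (Ψ : A ⊗[K] M →ₗ[K] A)
    (act : A →ₗ[K] M →ₗ[K] M) : A →ₗ[K] A →ₗ[K] A :=
  ((diagAct m act).compl₂ (cofreeMap π)).compr₂ Ψ

theorem rightProd_apply (m : A →ₗ[K] A →ₗ[K] A) (π : A →ₗ[K] M) (Ψ : A ⊗[K] M →ₗ[K] A)
    (act : A →ₗ[K] M →ₗ[K] M) (a b : A) :
    rightProd m π Ψ act a b = Ψ (diagAct m act a (cofreeMap π b)) := rfl

variable {m : A →ₗ[K] A →ₗ[K] A} {π : A →ₗ[K] M} {Ψ : A ⊗[K] M →ₗ[K] A}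
  {act : A →ₗ[K] M →ₗ[K] M}

/-- The coproduct is multiplicative, and applying `hact` to `a₂ * b₂` gives the two summands; in the
second one, `b₁ ε(b₂)` collapses to `b`. -/
theorem cofreeMap_mul (hm : IsHopf K m e)
    (hact : ∀ a b, π (m a b) = act a (π b) + counit (R := K) b • π a) (a b : A) :
    cofreeMap π (m a b) = diagAct m act a (cofreeMap π b) + rightAct M m (cofreeMap π a) b := by
  have key (x y : A ⊗[K] A) : π.lTensor A (TensorProduct.map₂ m m x y) =
      TensorProduct.map₂ m act x (π.lTensor A y) + rightAct M m (π.lTensor A x)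
        (TensorProduct.rid K A ((counit (R := K) (A := A)).lTensor A y)) := by
    induction x with
    | zero => simp
    | add x x' hx hx' =>
      simp only [map_add, LinearMap.add_apply, hx, hx']
      abel
    | tmul x x' =>
      induction y with
      | zero => simp
      | add y y' hy hy' =>
        simp only [map_add, hy, hy']
        abel
      | tmul y y' => simp [hact, TensorProduct.tmul_add, TensorProduct.tmul_smul]
  rw [cofreeMap_apply, hm.comul_mul, key, lTensor_counit_comul, TensorProduct.rid_tmul, one_smul]
  rfl

theorem mul_eq_leftProd_add_rightProd (hm : IsHopf K m e) (hΨ : IsCofreeInverse e π Ψ)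
    (hact : ∀ a b, π (m a b) = act a (π b) + counit (R := K) b • π a) (a b : A) :
    m a b = leftProd m π Ψ a b + rightProd m π Ψ act a b
      + (counit (R := K) a * counit (R := K) b) • e := by
  have h := hΨ.left_inv (m a b)
  rw [cofreeMap_mul hm hact, map_add, hm.counit_mul] at h
  rw [leftProd_apply, rightProd_apply, add_comm (Ψ _), h, sub_add_cancel]

theorem cofreeMap_unit (he : IsGroupLikeElem K e) (h0 : π e = 0) : cofreeMap π e = 0 := by
  simp [cofreeMap_apply, he.comul_eq_tmul_self, h0]

theorem leftProd_unit_left (he : IsGroupLikeElem K e) (h0 : π e = 0) (b : A) :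
    leftProd m π Ψ e b = 0 := by simp [leftProd_apply, cofreeMap_unit he h0]

theorem leftProd_unit_right (hm : IsHopf K m e) (hΨ : IsCofreeInverse e π Ψ) (a : A) :
    leftProd m π Ψ a e = a - counit (R := K) a • e := by
  have : m.flip e = LinearMap.id := LinearMap.ext hm.mul_one
  rw [leftProd_apply, rightAct_apply, this, LinearMap.rTensor_id, LinearMap.id_apply,
    hΨ.left_inv]

theorem rightProd_unit_left (he : IsGroupLikeElem K e) (hm : IsHopf K m e)
    (hΨ : IsCofreeInverse e π Ψ) (h0 : π e = 0)
    (hact : ∀ a b, π (m a b) = act a (π b) + counit (R := K) b • π a) (b : A) :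
    rightProd m π Ψ act e b = b - counit (R := K) b • e := by
  have h := mul_eq_leftProd_add_rightProd hm hΨ hact e b
  rw [hm.one_mul, leftProd_unit_left he h0, he.counit_eq_one, zero_add, one_mul] at h
  exact eq_sub_of_add_eq h.symm

theorem rightProd_unit_right (he : IsGroupLikeElem K e) (h0 : π e = 0) (a : A) :
    rightProd m π Ψ act a e = 0 := by simp [rightProd_apply, cofreeMap_unit he h0]

/-- The three dendriform axioms say that `A ⊗ M` is a bimodule: the right action is associative, it
commutes with the diagonal action, and the latter is an action because the coproduct is
multiplicative. -/
theorem leftProd_leftProd (hm : IsHopf K m e) (hΨ : IsCofreeInverse e π Ψ) (x y z : A) :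
    leftProd m π Ψ (leftProd m π Ψ x y) z = leftProd m π Ψ x (m y z) := by
  simp only [leftProd_apply, hΨ.right_inv]
  congr 1
  generalize cofreeMap π x = t
  induction t with
  | zero => simp
  | add t t' h h' => simp only [map_add, LinearMap.add_apply, h, h']
  | tmul a v => simp [hm.mul_assoc]

theorem leftProd_rightProd (hm : IsHopf K m e) (hΨ : IsCofreeInverse e π Ψ) (x y z : A) :
    leftProd m π Ψ (rightProd m π Ψ act x y) z = rightProd m π Ψ act x (leftProd m π Ψ y z) := by
  simp only [leftProd_apply, rightProd_apply, hΨ.right_inv, diagAct_apply]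
  congr 1
  generalize (comul x : A ⊗[K] A) = d
  generalize cofreeMap π y = t
  induction t with
  | zero => simp
  | add t t' h h' => simp only [map_add, LinearMap.add_apply, h, h']
  | tmul a v =>
    induction d with
    | zero => simp
    | add t t' h h' => simp only [map_add, LinearMap.add_apply, h, h']
    | tmul d d' => simp [hm.mul_assoc]

theorem rightProd_mul (hm : IsHopf K m e) (hΨ : IsCofreeInverse e π Ψ)
    (hmul : ∀ a b v, act (m a b) v = act a (act b v)) (x y z : A) :
    rightProd m π Ψ act (m x y) z = rightProd m π Ψ act x (rightProd m π Ψ act y z) := by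
  simp only [rightProd_apply, hΨ.right_inv, diagAct_apply, hm.comul_mul]
  congr 1
  generalize (comul x : A ⊗[K] A) = d
  generalize (comul y : A ⊗[K] A) = c
  generalize cofreeMap π z = t
  induction t with
  | zero => simp
  | add t t' h h' => simp only [map_add, h, h']
  | tmul a v =>
    induction c with
    | zero => simp
    | add t t' h h' => simp only [map_add, LinearMap.add_apply, h, h']
    | tmul c c' =>
      induction d with
      | zero => simp
      | add t t' h h' => simp only [map_add, LinearMap.add_apply, h, h']
      | tmul d d' => simp [hm.mul_assoc, hmul]

theorem rTensor_counit_cofreeMap (x : A) :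
    (counit (R := K) (A := A)).rTensor M (cofreeMap π x) = 1 ⊗ₜ π x := by
  rw [cofreeMap_apply, ← LinearMap.comp_apply, LinearMap.rTensor_comp_lTensor,
    ← LinearMap.lTensor_comp_rTensor, LinearMap.comp_apply, rTensor_counit_comul,
    LinearMap.lTensor_tmul]

/-- `π` is recovered from `cofreeMap π` by applying the counit to the left factor, and the counit is
multiplicative. For `b` in `A₊` this puts `a ≺ b` in the kernel of `π`. -/
theorem retraction_leftProd (hm : IsHopf K m e) (hΨ : IsCofreeInverse e π Ψ) (a b : A) :
    π (leftProd m π Ψ a b) = counit (R := K) b • π a := by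
  have h1 (t : A ⊗[K] M) : (counit (R := K) (A := A)).rTensor M (rightAct M m t b) =
      counit (R := K) b • (counit (R := K) (A := A)).rTensor M t := by
    induction t with
    | zero => simp
    | add t t' h h' => simp only [map_add, LinearMap.add_apply, h, h', smul_add]
    | tmul x v =>
      simp [hm.counit_mul, TensorProduct.smul_tmul', mul_comm]
  have h2 := rTensor_counit_cofreeMap (π := π) (leftProd m π Ψ a b)
  rw [leftProd_apply, hΨ.right_inv, h1, rTensor_counit_cofreeMap, ← leftProd_apply] at h2
  simpa using (congrArg (TensorProduct.lid K M) h2).symm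

/-- Decomposing the right factor of `Δ(x)` by `id = Ψ ∘ cofreeMap π + ε(·) e` and using
coassociativity moves the coproduct to the left factor of `A ⊗ M`. -/
theorem IsCofreeInverse.comul_eq (hΨ : IsCofreeInverse e π Ψ) (x : A) :
    comul x = Ψ.lTensor A (TensorProduct.assoc K A A M
      ((comul (R := K) (A := A)).rTensor M (cofreeMap π x))) + x ⊗ₜ[K] e := by
  have h1 : (LinearMap.id : A →ₗ[K] A) =
      Ψ ∘ₗ cofreeMap π + LinearMap.toSpanSingleton K A e ∘ₗ counit := by
    ext a
    simp [hΨ.left_inv]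
  have h2 := congrArg (fun f => LinearMap.lTensor A f (comul (R := K) x)) h1
  simp only [LinearMap.lTensor_id, LinearMap.lTensor_add, LinearMap.lTensor_comp,
    LinearMap.id_apply, LinearMap.add_apply, LinearMap.comp_apply, lTensor_counit_comul,
    coassoc_cofreeMap, LinearMap.lTensor_tmul, LinearMap.toSpanSingleton_apply, one_smul] at h2
  exact h2

/-- The right action is compatible with the comodule structure of `A ⊗ M`. On `A₊`, with `e ≺ b = 0`
and `a ≺ e = a`, this one formula contains all terms of the formula for the reduced coproduct. -/
theorem comul_leftProd (hm : IsHopf K m e) (hΨ : IsCofreeInverse e π Ψ) (a b : A) :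
    comul (leftProd m π Ψ a b) =
      TensorProduct.map₂ m (leftProd m π Ψ) (comul a) (comul b) + leftProd m π Ψ a b ⊗ₜ e := by
  have h1 (t : A ⊗[K] M) : TensorProduct.assoc K A A M
      ((comul (R := K) (A := A)).rTensor M (rightAct M m t b)) =
      TensorProduct.map₂ m (rightAct M m)
        (TensorProduct.assoc K A A M ((comul (R := K) (A := A)).rTensor M t)) (comul b) := by
    induction t with
    | zero => simp
    | add t t' h h' => simp only [map_add, LinearMap.add_apply, h, h']
    | tmul x v =>
      rw [rightAct_tmul, LinearMap.rTensor_tmul, LinearMap.rTensor_tmul, hm.comul_mul]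
      generalize (comul x : A ⊗[K] A) = c
      generalize (comul b : A ⊗[K] A) = d
      induction c with
      | zero => simp
      | add t t' h h' => simp only [map_add, LinearMap.add_apply, TensorProduct.add_tmul, h, h']
      | tmul c c' =>
        induction d with
        | zero => simp
        | add t t' h h' => simp only [map_add, TensorProduct.add_tmul, h, h']
        | tmul d d' => simp
  have h2 (c d : A ⊗[K] A) : TensorProduct.map₂ m (leftProd m π Ψ) c d =
      Ψ.lTensor A (TensorProduct.map₂ m (rightAct M m) ((cofreeMap π).lTensor A c) d) := by
    induction c with
    | zero => simp
    | add t t' h h' => simp only [map_add, LinearMap.add_apply, h, h']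
    | tmul c c' =>
      induction d with
      | zero => simp
      | add t t' h h' => simp only [map_add, h, h']
      | tmul d d' => simp [leftProd_apply]
  rw [hΨ.comul_eq, h2, coassoc_cofreeMap, ← h1, leftProd_apply, hΨ.right_inv]

theorem comul_rightProd (hm : IsHopf K m e) (hΨ : IsCofreeInverse e π Ψ)
    (hact : ∀ a b, π (m a b) = act a (π b) + counit (R := K) b • π a) (a b : A) :
    comul (rightProd m π Ψ act a b) =
      TensorProduct.map₂ m (rightProd m π Ψ act) (comul a) (comul b)
        + rightProd m π Ψ act a b ⊗ₜ e := by
  have h (a b : A) := mul_eq_leftProd_add_rightProd hm hΨ hact a b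
  -- As `≻` is the product minus `≺`, up to a multiple of `e`, its formula follows by subtraction.
  have h1 (c d : A ⊗[K] A) : TensorProduct.map₂ m (rightProd m π Ψ act) c d =
      TensorProduct.map₂ m m c d - TensorProduct.map₂ m (leftProd m π Ψ) c d
      - m (TensorProduct.rid K A ((counit (R := K) (A := A)).lTensor A c))
          (TensorProduct.rid K A ((counit (R := K) (A := A)).lTensor A d)) ⊗ₜ e := by
    induction c with
    | zero => simp
    | add t t' h h' =>
      simp only [map_add, LinearMap.add_apply, h, h', TensorProduct.add_tmul]
      abel
    | tmul c c' =>
      induction d with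
      | zero => simp
      | add t t' h h' =>
        simp only [map_add, h, h', TensorProduct.add_tmul]
        abel
      | tmul d d' =>
        simp only [TensorProduct.map₂_apply_tmul, TensorProduct.map_tmul, LinearMap.lTensor_tmul, TensorProduct.rid_tmul,
          map_smul, LinearMap.smul_apply]
        conv_rhs => enter [1, 1]; rw [h c' d']
        simp only [TensorProduct.tmul_add, TensorProduct.tmul_smul, ← TensorProduct.smul_tmul']
        module
  have h2 : rightProd m π Ψ act a b = m a b - leftProd m π Ψ a b
      - (counit (R := K) a * counit (R := K) b) • e := by
    rw [h a b]; abel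
  rw [h1, h2, map_sub, map_sub, map_smul, comul_leftProd hm hΨ, hm.comul_mul, hm.comul_one]
  simp only [lTensor_counit_comul, TensorProduct.rid_tmul, one_smul, TensorProduct.sub_tmul,
    ← TensorProduct.smul_tmul']
  abel

end Construction

/-! ### Restriction to `A₊`, and retractions from complements -/

section Restriction

variable {A : Type*} [AddCommGroup A] [Module K A] [Coalgebra K A] {e : A}

/-- The restriction to `A₊` of a product with values in `A₊`. -/
def restrictAug (P : A →ₗ[K] A →ₗ[K] A) (hP : ∀ a b, counit (R := K) (P a b) = 0) :
    augKer K A →ₗ[K] augKer K A →ₗ[K] augKer K A :=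
  LinearMap.mk₂ K (fun a b => ⟨P a b, hP a b⟩)
    (fun _ _ _ => Subtype.ext (by simp)) (fun _ _ _ => Subtype.ext (by simp))
    (fun _ _ _ => Subtype.ext (by simp)) (fun _ _ _ => Subtype.ext (by simp))

@[simp] theorem coe_restrictAug (P : A →ₗ[K] A →ₗ[K] A)
    (hP : ∀ a b, counit (R := K) (P a b) = 0) (a b : augKer K A) :
    (restrictAug P hP a b : A) = P a b := rfl

local notation "incl" => TensorProduct.map (Submodule.subtype (augKer K A))
  (Submodule.subtype (augKer K A))

theorem map_subtype_map₂ {P Q : A →ₗ[K] A →ₗ[K] A}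
    {p q : augKer K A →ₗ[K] augKer K A →ₗ[K] augKer K A} (hp : ∀ a b, (p a b : A) = P a b)
    (hq : ∀ a b, (q a b : A) = Q a b) (x y : augKer K A ⊗[K] augKer K A) :
    incl (TensorProduct.map₂ p q x y) = TensorProduct.map₂ P Q (incl x) (incl y) := by
  induction x with
  | zero => simp
  | add x x' hx hx' => simp only [map_add, LinearMap.add_apply, hx, hx']
  | tmul x x' =>
    induction y with
    | zero => simp
    | add y y' hy hy' => simp only [map_add, hy, hy']
    | tmul y y' => simp [hp, hq]

theorem map₂_map_subtype_tmul_left {P Q : A →ₗ[K] A →ₗ[K] A}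
    {f g : augKer K A →ₗ[K] augKer K A} {c d : A} (hf : ∀ a, (f a : A) = P c a)
    (hg : ∀ a, (g a : A) = Q d a) (x : augKer K A ⊗[K] augKer K A) :
    TensorProduct.map₂ P Q (c ⊗ₜ d) (incl x) = incl (TensorProduct.map f g x) := by
  induction x with
  | zero => simp
  | add x x' hx hx' => simp only [map_add, hx, hx']
  | tmul x x' => simp [hf, hg]

theorem map₂_map_subtype_tmul_right {P Q : A →ₗ[K] A →ₗ[K] A}
    {f g : augKer K A →ₗ[K] augKer K A} {c d : A} (hf : ∀ a, (f a : A) = P a c)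
    (hg : ∀ a, (g a : A) = Q a d) (x : augKer K A ⊗[K] augKer K A) :
    TensorProduct.map₂ P Q (incl x) (c ⊗ₜ d) = incl (TensorProduct.map f g x) := by
  induction x with
  | zero => simp
  | add x x' hx hx' => simp only [map_add, LinearMap.add_apply, hx, hx']
  | tmul x x' => simp [hf, hg]

/-- The compatibility of `≺` with the reduced coproduct, from a formula for the coproduct. -/
theorem redComul_left_of_comul (he : IsGroupLikeElem K e) {m P : A →ₗ[K] A →ₗ[K] A}
    {q p : augKer K A →ₗ[K] augKer K A →ₗ[K] augKer K A} (hq : ∀ a b, (q a b : A) = m a b)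
    (hp : ∀ a b, (p a b : A) = P a b) (hm1 : ∀ a, m e a = a) (hm2 : ∀ a, m a e = a)
    (hP1 : ∀ b, P e b = 0) (hP2 : ∀ a : augKer K A, P a e = a)
    (hΔ : ∀ a b, comul (P a b) = TensorProduct.map₂ m P (comul a) (comul b) + P a b ⊗ₜ e)
    (a b : augKer K A) : redComul he (p a b) =
      TensorProduct.map₂ q p (redComul he a) (redComul he b)
        + (q.flip b).rTensor (augKer K A) (redComul he a)
        + (p a).lTensor (augKer K A) (redComul he b)
        + (p.flip b).lTensor (augKer K A) (redComul he a) + b ⊗ₜ[K] a := by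
  apply map_subtype_injective
  -- Of the nine products in the expansion of `Δ(a)` and `Δ(b)`, the three involving `a ⊗ e` vanish
  -- by `e ≺ b = 0`, and `e ⊗ a ≺ b` cancels. The other five are the stated terms.
  have hz (c : A) (x : augKer K A ⊗[K] augKer K A) :
      TensorProduct.map₂ m P (c ⊗ₜ e) (incl x) = 0 := by
    induction x with
    | zero => simp
    | add x x' hx hx' => simp only [map_add, hx, hx', add_zero]
    | tmul x x' => simp [hP1]
  rw [map_subtype_redComul, hp, hΔ, comul_coe he a, comul_coe he b]
  simp only [map_add, LinearMap.add_apply, hz, map_subtype_map₂ hq hp]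
  rw [map₂_map_subtype_tmul_left (f := LinearMap.id) (g := p a) (fun _ => (hm1 _).symm) (hp a),
    map₂_map_subtype_tmul_right (f := q.flip b) (g := LinearMap.id) (fun _ => hq _ b)
      (fun _ => (hP2 _).symm),
    map₂_map_subtype_tmul_right (f := LinearMap.id) (g := p.flip b) (fun _ => (hm2 _).symm)
      (fun _ => hp _ b)]
  simp only [TensorProduct.map₂_apply_tmul, TensorProduct.map_tmul, hm1, hm2, hP1, hP2,
    TensorProduct.tmul_zero, Submodule.subtype_apply]
  simp only [LinearMap.lTensor, LinearMap.rTensor]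
  abel

/-- The compatibility of `≻` with the reduced coproduct, from a formula for the coproduct. -/
theorem redComul_right_of_comul (he : IsGroupLikeElem K e) {m P : A →ₗ[K] A →ₗ[K] A}
    {q p : augKer K A →ₗ[K] augKer K A →ₗ[K] augKer K A} (hq : ∀ a b, (q a b : A) = m a b)
    (hp : ∀ a b, (p a b : A) = P a b) (hm1 : ∀ a, m e a = a) (hm2 : ∀ a, m a e = a)
    (hP1 : ∀ b : augKer K A, P e b = b) (hP2 : ∀ a, P a e = 0)
    (hΔ : ∀ a b, comul (P a b) = TensorProduct.map₂ m P (comul a) (comul b) + P a b ⊗ₜ e)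
    (a b : augKer K A) : redComul he (p a b) =
      TensorProduct.map₂ q p (redComul he a) (redComul he b)
        + (q a).rTensor (augKer K A) (redComul he b)
        + (p a).lTensor (augKer K A) (redComul he b)
        + (p.flip b).lTensor (augKer K A) (redComul he a) + a ⊗ₜ[K] b := by
  apply map_subtype_injective
  have hz (c : A) (x : augKer K A ⊗[K] augKer K A) :
      TensorProduct.map₂ m P (incl x) (c ⊗ₜ e) = 0 := by
    induction x with
    | zero => simp
    | add x x' hx hx' => simp only [map_add, LinearMap.add_apply, hx, hx', add_zero]
    | tmul x x' => simp [hP2]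
  rw [map_subtype_redComul, hp, hΔ, comul_coe he a, comul_coe he b]
  simp only [map_add, LinearMap.add_apply, hz, map_subtype_map₂ hq hp]
  rw [map₂_map_subtype_tmul_left (f := LinearMap.id) (g := p a) (fun _ => (hm1 _).symm) (hp a),
    map₂_map_subtype_tmul_left (f := q a) (g := LinearMap.id) (hq a) (fun _ => (hP1 _).symm),
    map₂_map_subtype_tmul_right (f := LinearMap.id) (g := p.flip b) (fun _ => (hm2 _).symm)
      (fun _ => hp _ b)]
  simp only [TensorProduct.map₂_apply_tmul, TensorProduct.map_tmul, hm1, hm2, hP1, hP2,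
    TensorProduct.tmul_zero, Submodule.subtype_apply]
  simp only [LinearMap.lTensor, LinearMap.rTensor]
  abel

/-- A complement of the primitive elements in `A₊` is the kernel in `A₊` of a retraction. -/
theorem exists_retraction_of_complement (he : IsGroupLikeElem K e) {I : Submodule K A}
    (hinf : primitives K e ⊓ I = ⊥) (hsup : primitives K e ⊔ I = augKer K A) :
    ∃ π : A →ₗ[K] primitives K e, π e = 0 ∧ (∀ v : primitives K e, π v = v) ∧
      ∀ x, π x = 0 ↔ x - counit (R := K) x • e ∈ I := by
  have hI : I ≤ augKer K A := hsup ▸ le_sup_right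
  have hmem (x : A) : x ∈ I ⊔ Submodule.span K {e} ↔ x - counit (R := K) x • e ∈ I := by
    constructor
    · intro hx
      obtain ⟨i, hi, j, hj, rfl⟩ := Submodule.mem_sup.1 hx
      obtain ⟨c, rfl⟩ := Submodule.mem_span_singleton.1 hj
      have : counit (R := K) i = 0 := hI hi
      simpa [this, he.counit_eq_one] using hi
    · intro hx
      rw [← sub_add_cancel x (counit (R := K) x • e)]
      exact Submodule.add_mem_sup hx
        (Submodule.smul_mem _ _ (Submodule.mem_span_singleton_self e))
  -- The retraction is the projection along `I ⊕ K e`, so that it also vanishes on the unit.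
  have hc : IsCompl (primitives K e) (I ⊔ Submodule.span K {e}) := by
    constructor
    · rw [Submodule.disjoint_def]
      intro x hx hx'
      rw [hmem, counit_eq_zero_of_mem_primitives he hx, zero_smul, sub_zero] at hx'
      exact (Submodule.mem_bot K).1 (hinf ▸ Submodule.mem_inf.2 ⟨hx, hx'⟩)
    · rw [codisjoint_iff, ← sup_assoc, hsup, eq_top_iff]
      intro x _
      rw [augProj_add he x]
      exact Submodule.add_mem_sup (augProj he x).2
        (Submodule.smul_mem _ _ (Submodule.mem_span_singleton_self e))
  refine ⟨Submodule.projectionOnto _ _ hc, ?_, fun v => ?_, fun x => ?_⟩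
  · rw [Submodule.projectionOnto_apply_eq_zero_iff]
    exact Submodule.mem_sup_right (Submodule.mem_span_singleton_self e)
  · exact Submodule.projectionOnto_apply_left hc v
  · rw [Submodule.projectionOnto_apply_eq_zero_iff, hmem]

end Restriction

/-! ### The bijection -/

section Bijection

variable {A : Type v} [AddCommGroup A] [Module K A] [Coalgebra K A]

theorem Phi_mapsTo (hA : IsCofree K A) {e : A} (he : IsGroupLikeElem K e) :
    Set.MapsTo (Phi he) (DD he) (LI K A) := by
  rintro ⟨p, s⟩ hd
  have hd : IsDendriformHopf he p s := hd
  obtain ⟨π, -, hv, hπ, hle⟩ := hd.exists_retraction hA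
  have hI : Submodule.span K {x : A | ∃ a b : augKer K A, x = (p a b : A)} ≤ augKer K A := by
    rw [Submodule.span_le]
    rintro _ ⟨a, b, rfl⟩
    exact (p a b).2
  refine ⟨e, hd.isHopf, fun a x hx => ?_, ?_,
    le_antisymm (sup_le (primitives_le_augKer K A he) hI) hle⟩
  · change x ∈ Submodule.span K {x : A | ∃ a b : augKer K A, x = (p a b : A)} at hx
    change unitalExt he (p + s) a x ∈
      Submodule.span K {x : A | ∃ a b : augKer K A, x = (p a b : A)}
    induction hx using Submodule.span_induction with
    | mem x hx =>
      obtain ⟨b, c, rfl⟩ := hx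
      rw [augProj_add he a]
      simp only [map_add, map_smul, LinearMap.add_apply, LinearMap.smul_apply,
        unitalExt_unit_left, unitalExt_coe_coe, Submodule.coe_add]
      -- The left ideal property: `a ≻ (b ≺ c) = (a ≻ b) ≺ c` is again in `A₊ ≺ A₊`.
      rw [← hd.right_left]
      exact add_mem (add_mem (Submodule.subset_span ⟨_, _, rfl⟩)
        (Submodule.subset_span ⟨_, _, rfl⟩))
        (Submodule.smul_mem _ _ (Submodule.subset_span ⟨_, _, rfl⟩))
    | zero => simp
    | add x y _ _ hx hy => simpa using add_mem hx hy
    | smul c x _ hx => simpa using Submodule.smul_mem _ c hx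
  · rw [Submodule.eq_bot_iff]
    rintro x ⟨hx, hx'⟩
    have h0 : Submodule.span K {x : A | ∃ a b : augKer K A, x = (p a b : A)} ≤
        LinearMap.ker π := by
      rw [Submodule.span_le]
      rintro _ ⟨a, b, rfl⟩
      exact hπ a b
    have h1 := hv ⟨x, hx⟩
    rw [show π x = 0 from h0 hx'] at h1
    exact (congrArg Subtype.val h1).symm

theorem unitalExt_injective {e : A} (he : IsGroupLikeElem K e) :
    Function.Injective (unitalExt he) := by
  intro p q h
  ext a b
  rw [← unitalExt_coe_coe he, h, unitalExt_coe_coe]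

/-- One retraction `π` kills both spaces `A₊ ≺ A₊`, so `cofreeMap π` of `a ≺ b` depends only on `*`
and `π`; `cofreeMap π` is injective on `A₊`. -/
theorem Phi_injOn (hA : IsCofree K A) {e : A} (he : IsGroupLikeElem K e) :
    Set.InjOn (Phi he) (DD he) := by
  rintro ⟨p, s⟩ hd ⟨p', s'⟩ hd' h
  have hd : IsDendriformHopf he p s := hd
  have hd' : IsDendriformHopf he p' s' := hd'
  obtain ⟨hm, hI⟩ := Prod.ext_iff.1 h
  have hm : unitalExt he (p + s) = unitalExt he (p' + s') := hm
  obtain ⟨π, h0, hv, hπ, -⟩ := hd.exists_retraction hA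
  obtain ⟨Ψ, hΨ⟩ := hA.exists_inverse_of_retraction he h0 hv
  have hπ' (a b) : π (p' a b) = 0 := by
    have h1 : Submodule.span K {x : A | ∃ a b : augKer K A, x = (p a b : A)} ≤
        LinearMap.ker π := by
      rw [Submodule.span_le]
      rintro _ ⟨a, b, rfl⟩
      exact hπ a b
    have h2 : (p' a b : A) ∈
        Submodule.span K {x : A | ∃ a b : augKer K A, x = (p' a b : A)} :=
      Submodule.subset_span ⟨a, b, rfl⟩
    exact h1 (hI.symm ▸ h2 : (p' a b : A) ∈ (Phi he (p, s)).2)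
  have hp : p = p' := by
    ext a b
    have h1 := hΨ.left_inv (p a b)
    have h2 := hΨ.left_inv (p' a b)
    rw [hd.cofreeMap_left h0 hπ, hm, ← hd'.cofreeMap_left h0 hπ', h2] at h1
    simpa using h1.symm
  have hs := unitalExt_injective he hm
  subst hp
  have hs : s = s' := by
    ext a b
    simpa using congrArg (fun f => (f a b : A)) hs
  rw [hs]

theorem Phi_surjOn (hA : IsCofree K A) {e : A} (he : IsGroupLikeElem K e) :
    Set.SurjOn (Phi he) (DD he) (LI K A) := by
  rintro ⟨m, I⟩ ⟨u, hm, hideal, hinf, hsup⟩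
  -- The unit of any Hopf structure on `A` is group-like.
  obtain rfl : u = e := hA.groupLike_unique he ⟨hm.counit_one, hm.comul_one⟩
  simp only at hm hideal hinf hsup
  obtain ⟨π, h0, hv, hπI⟩ := exists_retraction_of_complement he hinf hsup
  obtain ⟨Ψ, hΨ⟩ := hA.exists_inverse_of_retraction he h0 hv
  set act : A →ₗ[K] primitives K u →ₗ[K] primitives K u :=
    (m.compr₂ π).compl₂ (Submodule.subtype _)
  have hactv (a : A) (v : primitives K u) : act a v = π (m a v) := rfl
  -- The element `b - π(b) - ε(b) u` lies in `I`, and stays there after left multiplication by `a`.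
  have hact (a b : A) : π (m a b) = act a (π b) + counit (R := K) b • π a := by
    have h1 : π (b - π b) = 0 := by rw [map_sub, hv, sub_self]
    have h2 := (hπI _).1 h1
    rw [map_sub, counit_eq_zero_of_mem_primitives he (π b).2, sub_zero] at h2
    have h3 : π (m a (b - π b - counit (R := K) b • u)) = 0 := by
      rw [hπI, hm.counit_mul]
      simpa [he.counit_eq_one, counit_eq_zero_of_mem_primitives he (π b).2] using hideal a _ h2
    rw [map_sub, map_sub, map_smul, hm.mul_one, map_sub, map_sub, map_smul, ← hactv] at h3
    rw [← sub_eq_zero, ← h3]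
    abel
  have hmul (a b : A) (v : primitives K u) : act (m a b) v = act a (act b v) := by
    rw [hactv, hm.mul_assoc, hact, hm.counit_mul, counit_eq_zero_of_mem_primitives he v.2,
      mul_zero, zero_smul, add_zero, ← hactv b]
  set P := leftProd m π Ψ with hP
  set S := rightProd m π Ψ act with hS
  have hPε (a b : A) : counit (R := K) (P a b) = 0 := hΨ.counit_apply he _
  have hSε (a b : A) : counit (R := K) (S a b) = 0 := hΨ.counit_apply he _
  set p := restrictAug P hPε with hp
  set s := restrictAug S hSε with hs
  have hps (a b : augKer K A) : (((p + s) a b : augKer K A) : A) = m a b := by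
    rw [mul_eq_leftProd_add_rightProd hm hΨ hact]
    simp [hp, hs, hP, hS]
  have hext : unitalExt he (p + s) = m := by
    ext a b
    rw [augProj_add he a, augProj_add he b]
    simp only [map_add, map_smul, LinearMap.add_apply, LinearMap.smul_apply, unitalExt_unit_left,
      unitalExt_unit_right, hm.one_mul, hm.mul_one, unitalExt_coe_coe, ← hps, Submodule.coe_add]
  have hd : IsDendriformHopf he p s :=
    { isHopf := hext ▸ hm
      left_left := fun x y z => Subtype.ext <| by
        rw [coe_restrictAug, coe_restrictAug, coe_restrictAug, hps]
        exact leftProd_leftProd hm hΨ _ _ _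
      right_left := fun x y z => Subtype.ext (leftProd_rightProd hm hΨ _ _ _)
      right_right := fun x y z => Subtype.ext <| by
        rw [coe_restrictAug, coe_restrictAug, coe_restrictAug, hps]
        exact rightProd_mul hm hΨ hmul _ _ _
      redComul_left := redComul_left_of_comul he hps (fun _ _ => rfl) hm.one_mul hm.mul_one
        (leftProd_unit_left he h0) (fun a => by simp [hP, leftProd_unit_right hm hΨ])
        (comul_leftProd hm hΨ)
      redComul_right := redComul_right_of_comul he hps (fun _ _ => rfl) hm.one_mul hm.mul_one
        (fun a => by simp [hS, rightProd_unit_left he hm hΨ h0 hact])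
        (rightProd_unit_right he h0) (comul_rightProd hm hΨ hact) }
  refine ⟨(p, s), hd, Prod.ext hext ?_⟩
  change Submodule.span K {x : A | ∃ a b : augKer K A, x = (p a b : A)} = I
  have hle : Submodule.span K {x : A | ∃ a b : augKer K A, x = (p a b : A)} ≤ I := by
    rw [Submodule.span_le]
    rintro _ ⟨a, b, rfl⟩
    have h1 := (hπI (p a b)).1 (by simp [hp, hP, retraction_leftProd hm hΨ])
    simpa using h1
  refine le_antisymm hle fun x hx => ?_
  -- As `Ψ(b ⊗ v) = v ≺ b`, the space `A₊` is the sum of `Prim(A)` and `A₊ ≺ A₊`. The latter is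
  -- contained in `I`, which meets `Prim(A)` trivially, so it is all of `I`.
  have hmem (t : A ⊗[K] primitives K u) : Ψ t ∈
      primitives K u ⊔ Submodule.span K {x : A | ∃ a b : augKer K A, x = (p a b : A)} := by
    induction t with
    | zero => simp
    | add t t' h h' => simpa using add_mem h h'
    | tmul b v =>
      have h1 : P v b = Ψ (b ⊗ₜ v) := by
        rw [hP, leftProd_apply, cofreeMap_of_mem_primitives h0 v.2, hv, rightAct_tmul, hm.one_mul]
      have h2 : P v u = v := by
        rw [hP, leftProd_unit_right hm hΨ, counit_eq_zero_of_mem_primitives he v.2, zero_smul,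
          sub_zero]
      rw [← h1, augProj_add he b, map_add, map_smul, h2, add_comm]
      exact Submodule.add_mem_sup (Submodule.smul_mem _ _ v.2) (Submodule.subset_span
        ⟨Submodule.inclusion (primitives_le_augKer K A he) v, augProj he b, rfl⟩)
  have hx0 : counit (R := K) x = 0 := (hsup ▸ le_sup_right : I ≤ augKer K A) hx
  have h1 := hmem (cofreeMap π x)
  rw [hΨ.left_inv, hx0, zero_smul, sub_zero] at h1
  obtain ⟨w, hw, y, hy, rfl⟩ := Submodule.mem_sup.1 h1
  have hwI : w ∈ I := by simpa using sub_mem hx (hle hy)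
  have hw0 : w = 0 := (Submodule.mem_bot K).1 (hinf ▸ Submodule.mem_inf.2 ⟨hw, hwI⟩)
  simpa [hw0] using hy

end Bijection

end CofreeDendriform

end

theorem theorem32 {K : Type*} [Field K] [CharZero K]
    {A : Type*} [AddCommGroup A] [Module K A] [Coalgebra K A]
    (hA : CofreeDendriform.IsCofree K A) (e : A) (he : IsGroupLikeElem K e) :
    Set.BijOn (CofreeDendriform.Phi he) (CofreeDendriform.DD he) (CofreeDendriform.LI K A) :=
  ⟨CofreeDendriform.Phi_mapsTo hA he, CofreeDendriform.Phi_injOn hA he,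
    CofreeDendriform.Phi_surjOn hA he⟩
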